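/- For a finite simple graph $G$, a set $D\subseteq V(G)$ is dominating if every vertex of $V(G)\setminus D$ is adjacent to some vertex of $D$; the domination number $\gamma(G)$ is the minimum cardinality of a dominating set of $G$. The graph $G$ is called $\gamma$-stable if $\gamma(G-w)=\gamma(G)$ for every vertex $w$ of $G$, where $G-w$ is obtained from $G$ by deleting $w$. For even $n\ge 2$ and $1\le\Delta\le\lfloor\log_2 n\rfloor$, the Knödel graph $W_{\Delta,n}$ is the bipartite graph with vertices $(i,j)$, $i\in\{1,2\}$, $0\le j\le n/2-1$, in which $(1,j)$ is adjacent to exactly the vertices $(2,(j+2^k-1)\bmod (n/2))$ for $k=0,1,\dots,\Delta-1$. Theorem. Let $n\ge 16$ be an even integer. Then $W_{4,n}$ is $\gamma$-stable if and only if one of the following holds: (i) $n=18$ or $n=28$; (ii) $n\equiv 0$ or $4\pmod{10}$; (iii) $n\equiv 6\pmod{10}$ and $n\ne 26$. -/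

import Mathlib

namespace SimpleGraph

/-- `D` is a dominating set of `G`: every vertex outside `D` is adjacent to some vertex of `D`. -/
def IsDominatingSet {V : Type*} (G : SimpleGraph V) (D : Finset V) : Prop :=
  ∀ u : V, u ∉ D → ∃ v ∈ D, G.Adj u v

/-- The domination number of a finite graph: the minimum cardinality of a dominating set
(the set of cardinalities is nonempty, since the whole vertex set is dominating). -/
noncomputable def dominationNumber {V : Type*} [Finite V] (G : SimpleGraph V) : ℕ :=
  sInf {k : ℕ | ∃ D : Finset V, G.IsDominatingSet D ∧ D.card = k}

/-- The graph `G - w` obtained by deleting the vertex `w`. -/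
def removeVertex {V : Type*} (G : SimpleGraph V) (w : V) : SimpleGraph {u : V // u ≠ w} :=
  G.comap Subtype.val

/-- `G` is domination vertex stable: deleting any vertex leaves the domination number unchanged. -/
def IsDominationStable {V : Type*} [Finite V] (G : SimpleGraph V) : Prop :=
  ∀ w : V, (G.removeVertex w).dominationNumber = G.dominationNumber

end SimpleGraph

/-- The Knödel graph `W_{Δ,n}` (for even `n ≥ 2` and `1 ≤ Δ ≤ ⌊log₂ n⌋`). The vertices are the
pairs `(i, j)` with `0 ≤ j ≤ n/2 - 1`, where the first coordinate `0` stands for the first part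
and `1` for the second part. For every `j` and every `k < Δ`, the vertex `j` of the first part is
adjacent to the vertex `(j + 2^k - 1) mod (n/2)` of the second part. -/
def knodelGraph (Δ n : ℕ) : SimpleGraph (Fin 2 × Fin (n / 2)) where
  Adj x y :=
    (x.1 = 0 ∧ y.1 = 1 ∧ ∃ k < Δ, (y.2 : ℕ) = (x.2 + 2 ^ k - 1) % (n / 2)) ∨
    (y.1 = 0 ∧ x.1 = 1 ∧ ∃ k < Δ, (x.2 : ℕ) = (y.2 + 2 ^ k - 1) % (n / 2))
  symm := ⟨fun _ _ h => h.symm⟩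
  loopless := ⟨fun x h => by
    rcases h with ⟨h0, h1, _⟩ | ⟨h0, h1, _⟩ <;> simp [h0] at h1⟩

/-! Put m = n/2 and read the two parts of a vertex set D as m-periodic 0/1 sequences A and B. The
`surplus` adds up, over all vertices, the members of D in the closed neighbourhood beyond the first;
the `deficit` counts uncovered vertices. Each member of D is counted five times, so surplus + 2m =
5|D| + deficit (`totalSurplus_add_two_mul`). Dominating sets have deficit 0, sets dominating G - w
have deficit at most 1, and lower bounds on |D| are lower bounds on the surplus.

Surplus 0 and deficit 0 are attained by the efficient pattern, with A at positions 3 and B at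
positions 2 modulo 5. The sequences form a closed walk of length m on pairs of windows. If the walk
meets the efficient pattern, it must shift the phase by m modulo 5, and every shift has a price in
surplus (`shiftCost_le_of_efficient`). If it avoids the pattern, a small surplus makes the average
weight per step small; the cycle lemma spreads this evenly, and a finite search finds no admissible
walk (`not_surplus_le`).

Write m = 5q + r. For r = 0, 2, 3 leaving one vertex uncovered saves nothing: 2q, 2q + 2, 2q + 3
vertices are needed and suffice to dominate. For r = 1, 4 it saves a vertex: 2q + 1 or 2q + 3
vertices miss only one vertex, while domination needs more. The sporadic m = 8, 9, 13, 14, 18 are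
settled separately. Deletion does not raise the domination number in the stable cases, since a
rotated minimum dominating set avoids w. -/

namespace Knodel

/-! The functions evaluated by the kernel in the searches below are written with the raw operations
of `Nat` and `Bool`, since unfolding the arithmetic type classes would dominate the evaluation. -/

/-! ### Finite searches over walks of windows -/

/-- Append the bit `x` to a window of seven consecutive bits, dropping the oldest one. -/
def push (a x : ℕ) : ℕ := Nat.mod (Nat.add (Nat.mul 2 a) x) 128

/-- The number of closed neighbours, in the set under consideration, of the vertex of the second
part at position `t + 7`: `a` is the window of the first part at `t`, and `x`, `y` are the bits
of both parts at `t + 7`. -/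
def sndCount (a x y : ℕ) : ℕ :=
  Nat.add (Nat.add (Nat.mod a 2) (Nat.add (Nat.mod (Nat.div a 4) 2) (Nat.div a 64))) (Nat.add x y)

/-- The number of closed neighbours, in the set under consideration, of the vertex of the first
part at position `t`. -/
def fstCount (a b y : ℕ) : ℕ :=
  Nat.add (Nat.add (Nat.add (Nat.div a 64) (Nat.div b 64))
    (Nat.add (Nat.mod (Nat.div b 32) 2) (Nat.mod (Nat.div b 8) 2))) y

/-- Subtraction is truncated, so surplus and deficit are the positive and negative parts of count
minus one, summed over the two vertices decided by positions `t` to `t + 7`. -/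
def surplus (a b x y : ℕ) : ℕ :=
  Nat.add (Nat.sub (sndCount a x y) 1) (Nat.sub (fstCount a b y) 1)

def deficit (a b x y : ℕ) : ℕ :=
  Nat.add (Nat.sub 1 (sndCount a x y)) (Nat.sub 1 (fstCount a b y))

/-- Search all continuations of a walk of windows. A branch is closed successfully when `prune`
holds, and the search fails when `check` fails at a node that is not pruned. The arguments of
`prune` and `check` are the time, both windows, the accumulated surplus and deficit. -/
noncomputable def explore (prune check : ℕ → ℕ → ℕ → ℕ → ℕ → Bool) : ℕ → ℕ → ℕ → ℕ → ℕ → ℕ → Bool :=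
  Nat.rec (fun _ _ _ _ _ => false) fun _ rec t a b p d =>
    (prune t a b p d).or ((check t a b p d).and (
      (rec t.succ (push a 0) (push b 0) (p.add (surplus a b 0 0)) (d.add (deficit a b 0 0))).and (
      (rec t.succ (push a 0) (push b 1) (p.add (surplus a b 0 1)) (d.add (deficit a b 0 1))).and (
      (rec t.succ (push a 1) (push b 0) (p.add (surplus a b 1 0)) (d.add (deficit a b 1 0))).and (
      rec t.succ (push a 1) (push b 1) (p.add (surplus a b 1 1)) (d.add (deficit a b 1 1)))))))

/-- The position in the periodic efficient pattern described by two windows, or `5` if the windows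
are not part of that pattern. -/
def phase (a b : ℕ) : ℕ :=
  cond ((Nat.beq a 8).and (Nat.beq b 16)) 0 <|
  cond ((Nat.beq a 16).and (Nat.beq b 33)) 1 <|
  cond ((Nat.beq a 33).and (Nat.beq b 66)) 2 <|
  cond ((Nat.beq a 66).and (Nat.beq b 4)) 3 <|
  cond ((Nat.beq a 4).and (Nat.beq b 8)) 4 5

/-- A lower bound for the surplus of a walk between two efficient windows which shifts the phase
by `δ` and has total deficit `d`. -/
def shiftCost (d δ : ℕ) : ℕ :=
  bif d == 0 then (bif δ == 0 then 0 else bif δ == 2 then 6 else 8)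
  else (bif δ == 0 then 0 else bif δ == 1 then 4 else 6)

/-- Only walks with `p + 2 * d ≤ 7` and `d ≤ 1` matter. The largest values of `shiftCost`, 8 for `d
= 0` and 6 for `d = 1`, sit exactly at the cutoff `p + 2 * d = 8`: they say that no cheaper shift
exists in that range. A branch also closes on a return to the pattern that has paid for its shift;
`excursionCheck` rejects a return that has not. -/
def excursionPrune (p₀ t a b p d : ℕ) : Bool :=
  (1).ble t && ((8).ble (p + 2 * d) || (2).ble d ||
    ((phase a b).ble 4 && (shiftCost d ((t + p₀ + 5 - phase a b) % 5)).ble p))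

def excursionCheck (t a b _p _d : ℕ) : Bool := t == 0 || phase a b == 5

/-- The third condition discards walks whose weight runs ahead of the average `(P + D) / m₀` per
step; the cycle lemma allows this. As `m₀ ≤ m`, one search serves all lengths `m`. -/
def loopPrune (P D m₀ t a b p d : ℕ) : Bool :=
  (P.succ.ble p).or ((D.succ.ble d).or
    ((((P.add D).mul t).succ.ble ((p.add d).mul m₀)).or ((phase a b).ble 4)))

def loopCheck (goal : ℕ → Bool) (sa sb t a b _p _d : ℕ) : Bool :=
  ((goal t).and ((a.beq sa).and (b.beq sb))).not

/-- Search all closed walks which avoid the efficient pattern and whose first step has neither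
surplus nor deficit. -/
noncomputable def loopSearch (P D m₀ : ℕ) (goal : ℕ → Bool) : Bool :=
  (List.range 128).all fun a => (2).ble (sndCount a 0 0) || (List.range 128).all fun b =>
    (2).ble (fstCount a b 0) ||
      explore (loopPrune P D m₀) (loopCheck goal a b) 45 0 a b 0 0

/-- Exhausted fuel counts as failure, so success also certifies that every branch closes within the
given depth. -/
theorem excursion_search :
    explore (excursionPrune 0) excursionCheck 60 0 8 16 0 0 = true ∧
    explore (excursionPrune 1) excursionCheck 60 0 16 33 0 0 = true ∧
    explore (excursionPrune 2) excursionCheck 60 0 33 66 0 0 = true ∧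
    explore (excursionPrune 3) excursionCheck 60 0 66 4 0 0 = true ∧
    explore (excursionPrune 4) excursionCheck 60 0 4 8 0 0 = true := by
  decide +kernel

/-- In this and the following searches `P = 5 * s + D - 2 * m` is the surplus of a set of `s`
vertices with deficit `D`, where `s` is one less than the size to be proved necessary. For `m = 5 *
q + r` with `r = 1, 2, 3, 4`, `s` is `2q + 1`, `2q + 1`, `2q + 2`, `2q + 3`; for `m = 8, 18, 13, 14`
it is 3, 7, 6, 6. -/
theorem loop_search_one :
    loopSearch 3 0 11 (fun t => (Nat.ble 11 t).and ((t.mod 5).beq 1)) = true := by decide +kernel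

theorem loop_search_two :
    loopSearch 2 1 12 (fun t => (Nat.ble 12 t).and ((t.mod 5).beq 2)) = true := by decide +kernel

theorem loop_search_three :
    loopSearch 5 1 23 (fun t => (Nat.ble 23 t).and ((t.mod 5).beq 3)) = true := by decide +kernel

theorem loop_search_four :
    loopSearch 7 0 19 (fun t => (Nat.ble 19 t).and ((t.mod 5).beq 4)) = true := by decide +kernel

theorem loop_search_eight_eighteen :
    loopSearch 0 1 8 (fun t => (t.beq 8).or (t.beq 18)) = true := by decide +kernel

theorem loop_search_thirteen : loopSearch 4 0 13 (·.beq 13) = true := by decide +kernel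

theorem loop_search_fourteen : loopSearch 3 1 14 (·.beq 14) = true := by decide +kernel

/-- Subadditivity lets the prices of consecutive excursions from the pattern be added. -/
theorem shiftCost_add_le : ∀ d < 2, ∀ e < 2, ∀ δ < 5, ∀ ε < 5, d + e < 2 →
    shiftCost (d + e) ((δ + ε) % 5) ≤ shiftCost d δ + shiftCost e ε := by
  decide

/-! ### Surplus and deficit of a pair of sequences -/

/-- The window of length seven of the sequence `A` at position `t`. -/
def window (A : ℕ → ℕ) (t : ℕ) : ℕ :=
  64 * A t + 32 * A (t + 1) + 16 * A (t + 2) + 8 * A (t + 3) + 4 * A (t + 4) + 2 * A (t + 5) +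
    A (t + 6)

def surplusAt (A B : ℕ → ℕ) (t : ℕ) : ℕ :=
  surplus (window A t) (window B t) (A (t + 7)) (B (t + 7))

def deficitAt (A B : ℕ → ℕ) (t : ℕ) : ℕ :=
  deficit (window A t) (window B t) (A (t + 7)) (B (t + 7))

def totalSurplus (A B : ℕ → ℕ) (t : ℕ) : ℕ := ∑ i ∈ Finset.range t, surplusAt A B i

def totalDeficit (A B : ℕ → ℕ) (t : ℕ) : ℕ := ∑ i ∈ Finset.range t, deficitAt A B i

theorem surplusAt_eq (A B : ℕ → ℕ) (t : ℕ) : surplusAt A B t =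
    (sndCount (window A t) (A (t + 7)) (B (t + 7)) - 1) +
      (fstCount (window A t) (window B t) (B (t + 7)) - 1) := rfl

theorem deficitAt_eq (A B : ℕ → ℕ) (t : ℕ) : deficitAt A B t =
    (1 - sndCount (window A t) (A (t + 7)) (B (t + 7))) +
      (1 - fstCount (window A t) (window B t) (B (t + 7))) := rfl

theorem sndCount_eq (a x y : ℕ) : sndCount a x y = sndCount a 0 0 + (x + y) := rfl

theorem fstCount_eq (a b y : ℕ) : fstCount a b y = fstCount a b 0 + y := rfl

theorem window_lt {A : ℕ → ℕ} (hA : ∀ t, A t ≤ 1) (t : ℕ) : window A t < 128 := by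
  have h0 := hA t
  have h1 := hA (t + 1)
  have h2 := hA (t + 2)
  have h3 := hA (t + 3)
  have h4 := hA (t + 4)
  have h5 := hA (t + 5)
  have h6 := hA (t + 6)
  unfold window
  omega

theorem push_window {A : ℕ → ℕ} (hA : ∀ t, A t ≤ 1) (t : ℕ) :
    push (window A t) (A (t + 7)) = window A (t + 1) := by
  have h0 := hA t
  have h1 := hA (t + 1)
  have h2 := hA (t + 2)
  have h3 := hA (t + 3)
  have h4 := hA (t + 4)
  have h5 := hA (t + 5)
  have h6 := hA (t + 6)
  have h7 := hA (t + 7)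
  change (2 * window A t + A (t + 7)) % 128 = _
  unfold window
  simp only [add_assoc, Nat.reduceAdd]
  omega

theorem totalSurplus_succ (A B : ℕ → ℕ) (t : ℕ) :
    totalSurplus A B (t + 1) = totalSurplus A B t + surplusAt A B t :=
  Finset.sum_range_succ _ _

theorem totalDeficit_succ (A B : ℕ → ℕ) (t : ℕ) :
    totalDeficit A B (t + 1) = totalDeficit A B t + deficitAt A B t :=
  Finset.sum_range_succ _ _

theorem totalSurplus_mono (A B : ℕ → ℕ) : Monotone (totalSurplus A B) := fun _ _ h =>
  Finset.sum_le_sum_of_subset (Finset.range_mono h)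

theorem totalDeficit_mono (A B : ℕ → ℕ) : Monotone (totalDeficit A B) := fun _ _ h =>
  Finset.sum_le_sum_of_subset (Finset.range_mono h)

theorem totalSurplus_add (A B : ℕ → ℕ) (s t : ℕ) :
    totalSurplus A B (s + t) =
      totalSurplus A B s + totalSurplus (fun i => A (s + i)) (fun i => B (s + i)) t := by
  simp only [totalSurplus, Finset.sum_range_add]
  rfl

theorem totalDeficit_add (A B : ℕ → ℕ) (s t : ℕ) :
    totalDeficit A B (s + t) =
      totalDeficit A B s + totalDeficit (fun i => A (s + i)) (fun i => B (s + i)) t := by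
  simp only [totalDeficit, Finset.sum_range_add]
  rfl

theorem window_shift (A : ℕ → ℕ) (s t : ℕ) :
    window (fun i => A (s + i)) t = window A (s + t) := rfl

/-- The actual sequences select one of the four branches at each node; following it must end at a
pruned node, with `check` true at every earlier one. -/
theorem explore_sound {A B : ℕ → ℕ} (hA : ∀ t, A t ≤ 1) (hB : ∀ t, B t ≤ 1)
    {prune check : ℕ → ℕ → ℕ → ℕ → ℕ → Bool} (f : ℕ) : ∀ t,
    explore prune check f t (window A t) (window B t) (totalSurplus A B t)
      (totalDeficit A B t) = true →
    ∃ u, t ≤ u ∧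
      prune u (window A u) (window B u) (totalSurplus A B u) (totalDeficit A B u) = true ∧
      ∀ i, t ≤ i → i < u →
        check i (window A i) (window B i) (totalSurplus A B i) (totalDeficit A B i) = true := by
  induction f with
  | zero => intro t h; exact absurd h Bool.false_ne_true
  | succ f ih =>
    intro t h
    change (prune _ _ _ _ _ || (check _ _ _ _ _ && (explore _ _ f _ _ _ _ _ &&
      (explore _ _ f _ _ _ _ _ && (explore _ _ f _ _ _ _ _ && explore _ _ f _ _ _ _ _))))) = true at h
    rw [Bool.or_eq_true] at h
    rcases h with h | h
    · exact ⟨t, le_rfl, h, fun i h1 h2 => absurd h1 (by omega)⟩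
    simp only [Bool.and_eq_true] at h
    obtain ⟨hc, h00, h01, h10, h11⟩ := h
    have key : explore prune check f (t + 1) (window A (t + 1)) (window B (t + 1))
        (totalSurplus A B (t + 1)) (totalDeficit A B (t + 1)) = true := by
      rw [← push_window hA, ← push_window hB, totalSurplus_succ, totalDeficit_succ, surplusAt,
        deficitAt]
      have hx : A (t + 7) = 0 ∨ A (t + 7) = 1 := by have := hA (t + 7); omega
      have hy : B (t + 7) = 0 ∨ B (t + 7) = 1 := by have := hB (t + 7); omega
      rcases hx with hx | hx <;> rcases hy with hy | hy <;> rw [hx, hy] <;> assumption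
    obtain ⟨u, hu, hp, hi⟩ := ih (t + 1) key
    refine ⟨u, by omega, hp, fun i h1 h2 => ?_⟩
    rcases h1.eq_or_lt with rfl | h1
    · exact hc
    · exact hi i h1 h2

/-! ### Walks that start and end in the efficient pattern -/

theorem phase_le_four_cases {a b : ℕ} (h : phase a b ≤ 4) :
    (phase a b = 0 ∧ a = 8 ∧ b = 16) ∨ (phase a b = 1 ∧ a = 16 ∧ b = 33) ∨
    (phase a b = 2 ∧ a = 33 ∧ b = 66) ∨ (phase a b = 3 ∧ a = 66 ∧ b = 4) ∨
    (phase a b = 4 ∧ a = 4 ∧ b = 8) := by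
  unfold phase at *
  simp only [Bool.cond_eq_ite, Bool.and_eq_true, Nat.beq_eq] at *
  split_ifs at * <;> simp_all

theorem exists_next_efficient {A B : ℕ → ℕ} (hA : ∀ t, A t ≤ 1) (hB : ∀ t, B t ≤ 1) {m : ℕ}
    (hm : 0 < m) (hcost : totalSurplus A B m + 2 * totalDeficit A B m ≤ 7)
    (hdef : totalDeficit A B m ≤ 1) (h0 : phase (window A 0) (window B 0) ≤ 4)
    (hend : phase (window A m) (window B m) ≤ 4) :
    ∃ t, 0 < t ∧ t ≤ m ∧ phase (window A t) (window B t) ≤ 4 ∧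
      shiftCost (totalDeficit A B t)
        ((t + phase (window A 0) (window B 0) + 5 - phase (window A t) (window B t)) % 5) ≤
        totalSurplus A B t := by
  have key : explore (excursionPrune (phase (window A 0) (window B 0))) excursionCheck 60 0
      (window A 0) (window B 0) 0 0 = true := by
    obtain ⟨e0, e1, e2, e3, e4⟩ := excursion_search
    generalize window A 0 = a, window B 0 = b at h0 ⊢
    rcases phase_le_four_cases h0 with ⟨h, rfl, rfl⟩ | ⟨h, rfl, rfl⟩ | ⟨h, rfl, rfl⟩ | ⟨h, rfl, rfl⟩ |
      ⟨h, rfl, rfl⟩ <;> rw [h]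
    exacts [e0, e1, e2, e3, e4]
  obtain ⟨u, -, hp, hi⟩ := explore_sound hA hB 60 0 key
  have hum : u ≤ m := by
    -- If the branch were still open at `m`, `excursionCheck` would hold there, although `m > 0` and
    -- the windows at `m` are efficient.
    by_contra hlt
    have := hi m (Nat.zero_le _) (by omega)
    simp only [excursionCheck, Bool.or_eq_true, beq_iff_eq] at this
    omega
  have hs := totalSurplus_mono A B hum
  have hd := totalDeficit_mono A B hum
  simp only [excursionPrune, Bool.or_eq_true, Bool.and_eq_true, Nat.ble_eq] at hp
  obtain ⟨h1, (h2 | h2) | h2⟩ := hp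
  · omega
  · omega
  · exact ⟨u, h1, hum, h2.1, h2.2⟩

/-- Cut the walk at its next paid return to the pattern and apply induction to the rest: phase
shifts, surpluses and deficits all add. -/
theorem shiftCost_le_of_efficient (m : ℕ) : ∀ {A B : ℕ → ℕ}, (∀ t, A t ≤ 1) → (∀ t, B t ≤ 1) →
    totalSurplus A B m + 2 * totalDeficit A B m ≤ 7 → totalDeficit A B m ≤ 1 →
    phase (window A 0) (window B 0) ≤ 4 → phase (window A m) (window B m) ≤ 4 →
    shiftCost (totalDeficit A B m)
      ((m + phase (window A 0) (window B 0) + 5 - phase (window A m) (window B m)) % 5) ≤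
      totalSurplus A B m := by
  induction m using Nat.strong_induction_on with
  | _ m ih =>
    intro A B hA hB hcost hdef h0 hend
    rcases Nat.eq_zero_or_pos m with rfl | hm
    · have : (0 + phase (window A 0) (window B 0) + 5 - phase (window A 0) (window B 0)) % 5
          = 0 := by omega
      rw [this]
      simp [totalDeficit, totalSurplus, shiftCost]
    obtain ⟨t, ht, htm, hph, hle⟩ := exists_next_efficient hA hB hm hcost hdef h0 hend
    obtain ⟨r, rfl⟩ := Nat.exists_eq_add_of_le htm
    rw [totalSurplus_add, totalDeficit_add] at hcost
    rw [totalDeficit_add] at hdef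
    have hrec := ih r (by omega) (A := fun i => A (t + i)) (B := fun i => B (t + i))
      (fun _ => hA _) (fun _ => hB _) (by omega) (by omega) (by simpa [window_shift] using hph)
      (by simpa [window_shift] using hend)
    simp only [window_shift, Nat.add_zero] at hrec
    rw [totalSurplus_add, totalDeficit_add]
    have hadd := shiftCost_add_le (totalDeficit A B t) (by omega)
      (totalDeficit (fun i => A (t + i)) (fun i => B (t + i)) r) (by omega)
      ((t + phase (window A 0) (window B 0) + 5 - phase (window A t) (window B t)) % 5)
      (Nat.mod_lt _ (by omega))
      ((r + phase (window A t) (window B t) + 5 -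
        phase (window A (t + r)) (window B (t + r))) % 5) (Nat.mod_lt _ (by omega)) (by omega)
    have hmod : ((t + phase (window A 0) (window B 0) + 5 -
        phase (window A t) (window B t)) % 5 + (r + phase (window A t) (window B t) + 5 -
        phase (window A (t + r)) (window B (t + r))) % 5) % 5 =
        (t + r + phase (window A 0) (window B 0) + 5 -
          phase (window A (t + r)) (window B (t + r))) % 5 := by omega
    rw [hmod] at hadd
    omega

/-! ### Closed walks -/

/-- The cycle lemma: a periodic sequence can be rotated so that all its partial sums are at most
proportional. -/
theorem exists_rotation {w : ℕ → ℕ} {m : ℕ} (hm : 0 < m) (hw : ∀ t, w (t + m) = w t) :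
    ∃ s, ∀ t, (∑ i ∈ Finset.range t, w (s + i)) * m ≤ (∑ i ∈ Finset.range m, w i) * t := by
  set W := ∑ i ∈ Finset.range m, w i with hW
  let g : ℕ → ℤ := fun t => (∑ i ∈ Finset.range t, (w i : ℤ)) * m - W * t
  have hgm : ∀ t, g (t + m) = g t := by
    intro t
    have h1 : ∑ i ∈ Finset.range (t + m), (w i : ℤ) = W + ∑ i ∈ Finset.range t, (w i : ℤ) := by
      rw [add_comm t m, Finset.sum_range_add, hW]
      push_cast
      congr 1
      exact Finset.sum_congr rfl fun i _ => by rw [add_comm m i, hw]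
    simp only [g, h1]
    push_cast
    ring
  have hgmod : ∀ t, g t = g (t % m) := fun t => (Function.Periodic.map_mod_nat hgm t).symm
  -- Start where the partial sums lie highest above the line of mean slope; from there they cannot
  -- rise above that slope.
  obtain ⟨s, -, hs⟩ := Finset.exists_max_image (Finset.range m) g ⟨0, by simpa⟩
  refine ⟨s, fun t => ?_⟩
  have h := hs ((s + t) % m) (Finset.mem_range.2 (Nat.mod_lt _ hm))
  rw [← hgmod] at h
  simp only [g, Finset.sum_range_add] at h
  push_cast at h
  zify
  linarith

theorem sum_range_shift {M : Type*} [AddCommMonoid M] {w : ℕ → M} {m : ℕ}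
    (hw : ∀ t, w (t + m) = w t) (s : ℕ) :
    ∑ i ∈ Finset.range m, w (s + i) = ∑ i ∈ Finset.range m, w i := by
  induction s with
  | zero => simp
  | succ s ih =>
    rw [← ih]
    cases m with
    | zero => simp
    | succ m =>
      rw [Finset.sum_range_succ, Finset.sum_range_succ' (fun i => w (s + i))]
      congr 1
      · exact Finset.sum_congr rfl fun i _ => by congr 1; omega
      · rw [← hw (s + 0)]
        congr 1
        omega

theorem periodic_shift {A : ℕ → ℕ} {m : ℕ} (hA : ∀ t, A (t + m) = A t) (s t : ℕ) :
    A (s + (t + m)) = A (s + t) := by rw [← add_assoc, hA]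

theorem window_periodic {A : ℕ → ℕ} {m : ℕ} (hA : ∀ t, A (t + m) = A t) (t : ℕ) :
    window A (t + m) = window A t := by
  simp only [window, Nat.add_right_comm t m, hA]

theorem surplusAt_periodic {A B : ℕ → ℕ} {m : ℕ} (hA : ∀ t, A (t + m) = A t)
    (hB : ∀ t, B (t + m) = B t) (t : ℕ) : surplusAt A B (t + m) = surplusAt A B t := by
  simp only [surplusAt, window_periodic hA, window_periodic hB, Nat.add_right_comm t m, hA, hB]

theorem deficitAt_periodic {A B : ℕ → ℕ} {m : ℕ} (hA : ∀ t, A (t + m) = A t)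
    (hB : ∀ t, B (t + m) = B t) (t : ℕ) : deficitAt A B (t + m) = deficitAt A B t := by
  simp only [deficitAt, window_periodic hA, window_periodic hB, Nat.add_right_comm t m, hA, hB]

/-- A closed walk through an efficient window returns with phase shift `m % 5`, excluded by `hcost`;
one that avoids the pattern is excluded by `hsearch`. -/
theorem not_surplus_le {A B : ℕ → ℕ} {m P D m₀ : ℕ} {goal : ℕ → Bool} (hm : 0 < m)
    (hA : ∀ t, A t ≤ 1) (hB : ∀ t, B t ≤ 1) (hAm : ∀ t, A (t + m) = A t)
    (hBm : ∀ t, B (t + m) = B t) (hsearch : loopSearch P D m₀ goal = true) (hm₀ : m₀ ≤ m)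
    (hgoal : goal m = true) (hPDm : P + D < m₀) (hPD : P + 2 * D ≤ 7) (hD : D ≤ 1)
    (hcost : ∀ d ≤ D, P < shiftCost d (m % 5)) (hdef : totalDeficit A B m ≤ D) :
    P < totalSurplus A B m := by
  by_contra! hP
  have hS : ∀ s, totalSurplus (fun i => A (s + i)) (fun i => B (s + i)) m =
      totalSurplus A B m := fun s => sum_range_shift (surplusAt_periodic hAm hBm) s
  have hDf : ∀ s, totalDeficit (fun i => A (s + i)) (fun i => B (s + i)) m =
      totalDeficit A B m := fun s => sum_range_shift (deficitAt_periodic hAm hBm) s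
  by_cases heff : ∃ s, phase (window A s) (window B s) ≤ 4
  · obtain ⟨s, hs⟩ := heff
    have h := shiftCost_le_of_efficient m (A := fun i => A (s + i)) (B := fun i => B (s + i))
      (fun _ => hA _) (fun _ => hB _) (by rw [hS, hDf]; omega) (by rw [hDf]; omega)
      (by simpa [window_shift] using hs)
      (by simpa [window_shift, window_periodic hAm, window_periodic hBm] using hs)
    rw [hS, hDf] at h
    simp only [window_shift, window_periodic hAm, window_periodic hBm, Nat.add_zero] at h
    have h5 : (m + phase (window A s) (window B s) + 5 - phase (window A s) (window B s)) % 5 =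
        m % 5 := by omega
    rw [h5] at h
    have := hcost _ hdef
    omega
  · push Not at heff
    obtain ⟨s, hs⟩ := exists_rotation (w := fun t => surplusAt A B t + deficitAt A B t) hm
      fun t => by simp only [surplusAt_periodic hAm hBm, deficitAt_periodic hAm hBm]
    set A' : ℕ → ℕ := fun i => A (s + i) with hA'
    set B' : ℕ → ℕ := fun i => B (s + i) with hB'
    have hA1 : ∀ t, A' t ≤ 1 := fun _ => hA _
    have hB1 : ∀ t, B' t ≤ 1 := fun _ => hB _
    have hbound : ∀ t, (totalSurplus A' B' t + totalDeficit A' B' t) * m ≤ (P + D) * t := by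
      intro t
      have h1 := hs t
      simp only [Finset.sum_add_distrib] at h1
      refine (show _ ≤ _ from h1).trans (Nat.mul_le_mul_right _ (Nat.add_le_add hP hdef))
    -- The first step has integral weight at most `(P + D) / m < 1`, which justifies the restriction
    -- on starting windows in `loopSearch`.
    have hfirst : surplusAt A' B' 0 + deficitAt A' B' 0 = 0 := by
      have h1 := hbound 1
      simp only [totalSurplus, totalDeficit, Finset.sum_range_one] at h1
      by_contra hne
      have := Nat.mul_le_mul_right m (Nat.one_le_iff_ne_zero.2 hne)
      omega
    rw [surplusAt_eq, deficitAt_eq, sndCount_eq, fstCount_eq] at hfirst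
    simp only [loopSearch, List.all_eq_true, List.mem_range, Bool.or_eq_true, Nat.ble_eq]
      at hsearch
    obtain ⟨u, -, hp, hi⟩ := explore_sound hA1 hB1 45 0
      (((hsearch _ (window_lt hA1 0)).resolve_left (by omega) _
        (window_lt hB1 0)).resolve_left (by omega))
    have hum : u ≤ m := by
      -- Beyond `m` the branch would have passed `loopCheck` at `m`, where by periodicity both
      -- windows are the initial ones again.
      by_contra hlt
      have := hi m (Nat.zero_le _) (by omega)
      have hw1 : window A' m = window A' 0 := by
        have := window_periodic (A := A') (fun t => periodic_shift hAm s t) 0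
        simpa using this
      have hw2 : window B' m = window B' 0 := by
        have := window_periodic (A := B') (fun t => periodic_shift hBm s t) 0
        simpa using this
      simp [loopCheck, hgoal, hw1, hw2] at this
    have hsu := totalSurplus_mono A' B' hum
    have hdu := totalDeficit_mono A' B' hum
    have e1 : totalSurplus A' B' m = totalSurplus A B m := hS s
    have e2 : totalDeficit A' B' m = totalDeficit A B m := hDf s
    have hb : (totalSurplus A' B' u + totalDeficit A' B' u) * m₀ ≤ (P + D) * u :=
      (Nat.mul_le_mul_left _ hm₀).trans (hbound u)
    have hph : 4 < phase (window A' u) (window B' u) := heff (s + u)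
    simp only [loopPrune, Bool.or_eq_true, Nat.ble_eq, Nat.mul_eq, Nat.add_eq] at hp
    omega

end Knodel

/-! ### Domination numbers and vertex deletion -/

namespace SimpleGraph

variable {V : Type*} {G : SimpleGraph V}

theorem dominationNumber_le_iff [Finite V] {k : ℕ} :
    G.dominationNumber ≤ k ↔ ∃ D : Finset V, G.IsDominatingSet D ∧ D.card ≤ k := by
  constructor
  · intro h
    have hne : {k : ℕ | ∃ D : Finset V, G.IsDominatingSet D ∧ D.card = k}.Nonempty := by
      have := Fintype.ofFinite V
      exact ⟨(Finset.univ : Finset V).card, Finset.univ, fun u hu => absurd (Finset.mem_univ u) hu, rfl⟩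
    obtain ⟨D, hD, hk⟩ : ∃ D : Finset V, G.IsDominatingSet D ∧ D.card = G.dominationNumber :=
      Nat.sInf_mem hne
    exact ⟨D, hD, hk.trans_le h⟩
  · rintro ⟨D, hD, hk⟩
    have hmem : D.card ∈ {k : ℕ | ∃ D : Finset V, G.IsDominatingSet D ∧ D.card = k} :=
      ⟨D, hD, rfl⟩
    exact (Nat.sInf_le hmem).trans hk

/-- `u` belongs to `D` or has a neighbour in `D`. -/
def Covers (G : SimpleGraph V) (D : Finset V) (u : V) : Prop := u ∈ D ∨ ∃ v ∈ D, G.Adj u v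

theorem isDominatingSet_iff {D : Finset V} : G.IsDominatingSet D ↔ ∀ u, G.Covers D u :=
  forall_congr' fun _ => or_iff_not_imp_left.symm

theorem removeVertex_dominationNumber_le_iff [Finite V] {w : V} {k : ℕ} :
    (G.removeVertex w).dominationNumber ≤ k ↔
      ∃ D : Finset V, w ∉ D ∧ (∀ u ≠ w, G.Covers D u) ∧ D.card ≤ k := by
  classical
  rw [dominationNumber_le_iff]
  constructor
  · rintro ⟨D, hD, hk⟩
    refine ⟨D.map (Function.Embedding.subtype _), by simp, fun u hu => ?_, by simpa using hk⟩
    by_cases hmem : (⟨u, hu⟩ : {u // u ≠ w}) ∈ D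
    · exact Or.inl (by simp [hmem, hu])
    · obtain ⟨v, hv, hadj⟩ := hD _ hmem
      exact Or.inr ⟨v, by simp [hv, v.2], hadj⟩
  · rintro ⟨D, hw, hD, hk⟩
    refine ⟨D.subtype (· ≠ w), fun u hu => ?_, ?_⟩
    · rcases hD u u.2 with h | ⟨v, hv, hadj⟩
      · exact absurd (by simpa using h) hu
      · exact ⟨⟨v, fun h => hw (h ▸ hv)⟩, by simpa using hv, hadj⟩
    · rw [Finset.card_subtype]
      exact (Finset.card_filter_le _ _).trans hk

end SimpleGraph

/-! ### From vertex sets to periodic sequences -/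

namespace Knodel

/-- The sequences `A` and `B` are the indicators of both parts of `D`, read periodically. -/
structure Describes {m : ℕ} (D : Finset (Fin 2 × Fin m)) (A B : ℕ → ℕ) : Prop where
  fst_le : ∀ t, A t ≤ 1
  snd_le : ∀ t, B t ≤ 1
  fst_periodic : ∀ t, A (t + m) = A t
  snd_periodic : ∀ t, B (t + m) = B t
  mem_fst : ∀ j : Fin m, ((0, j) : Fin 2 × Fin m) ∈ D ↔ A j = 1
  mem_snd : ∀ j : Fin m, ((1, j) : Fin 2 × Fin m) ∈ D ↔ B j = 1

theorem exists_describes {m : ℕ} (hm : 0 < m) (D : Finset (Fin 2 × Fin m)) :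
    ∃ A B, Describes D A B := by
  classical
  refine ⟨fun t => if ((0, ⟨t % m, Nat.mod_lt _ hm⟩) : Fin 2 × Fin m) ∈ D then 1 else 0,
    fun t => if ((1, ⟨t % m, Nat.mod_lt _ hm⟩) : Fin 2 × Fin m) ∈ D then 1 else 0,
    fun t => ?_, fun t => ?_, fun t => ?_, fun t => ?_, fun j => ?_, fun j => ?_⟩
  · split_ifs <;> omega
  · split_ifs <;> omega
  · simp only [Nat.add_mod_right]
  · simp only [Nat.add_mod_right]
  · simp [Nat.mod_eq_of_lt j.2]
  · simp [Nat.mod_eq_of_lt j.2]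

theorem describes_filter {m : ℕ} {A B : ℕ → ℕ} (hA : ∀ t, A t ≤ 1) (hB : ∀ t, B t ≤ 1)
    (hAm : ∀ t, A (t + m) = A t) (hBm : ∀ t, B (t + m) = B t) :
    Describes (Finset.univ.filter fun x : Fin 2 × Fin m =>
      x.1 = 0 ∧ A x.2 = 1 ∨ x.1 = 1 ∧ B x.2 = 1) A B :=
  ⟨hA, hB, hAm, hBm, fun j => by simp, fun j => by simp⟩

theorem fstCount_window {A B : ℕ → ℕ} (hA : ∀ t, A t ≤ 1) (hB : ∀ t, B t ≤ 1) (t : ℕ) :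
    fstCount (window A t) (window B t) (B (t + 7)) =
      A t + B t + B (t + 1) + B (t + 3) + B (t + 7) := by
  change window A t / 64 + window B t / 64 + (window B t / 32 % 2 + window B t / 8 % 2) +
    B (t + 7) = _
  have h0 := hA t
  have h1 := hA (t + 1)
  have h2 := hA (t + 2)
  have h3 := hA (t + 3)
  have h4 := hA (t + 4)
  have h5 := hA (t + 5)
  have h6 := hA (t + 6)
  have k0 := hB t
  have k1 := hB (t + 1)
  have k2 := hB (t + 2)
  have k3 := hB (t + 3)
  have k4 := hB (t + 4)
  have k5 := hB (t + 5)
  have k6 := hB (t + 6)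
  unfold window
  have e1 : (64 * A t + 32 * A (t + 1) + 16 * A (t + 2) + 8 * A (t + 3) + 4 * A (t + 4) +
    2 * A (t + 5) + A (t + 6)) / 64 = A t := by omega
  have e2 : (64 * B t + 32 * B (t + 1) + 16 * B (t + 2) + 8 * B (t + 3) + 4 * B (t + 4) +
    2 * B (t + 5) + B (t + 6)) / 64 = B t := by omega
  have e3 : (64 * B t + 32 * B (t + 1) + 16 * B (t + 2) + 8 * B (t + 3) + 4 * B (t + 4) +
    2 * B (t + 5) + B (t + 6)) / 32 % 2 = B (t + 1) := by omega
  have e4 : (64 * B t + 32 * B (t + 1) + 16 * B (t + 2) + 8 * B (t + 3) + 4 * B (t + 4) +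
    2 * B (t + 5) + B (t + 6)) / 8 % 2 = B (t + 3) := by omega
  rw [e1, e2, e3, e4]
  omega

theorem sndCount_window {A B : ℕ → ℕ} (hA : ∀ t, A t ≤ 1) (t : ℕ) :
    sndCount (window A t) (A (t + 7)) (B (t + 7)) =
      B (t + 7) + A (t + 7) + A (t + 6) + A (t + 4) + A t := by
  change window A t % 2 + (window A t / 4 % 2 + window A t / 64) + (A (t + 7) + B (t + 7)) = _
  have h0 := hA t
  have h1 := hA (t + 1)
  have h2 := hA (t + 2)
  have h3 := hA (t + 3)
  have h4 := hA (t + 4)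
  have h5 := hA (t + 5)
  have h6 := hA (t + 6)
  unfold window
  have e1 : (64 * A t + 32 * A (t + 1) + 16 * A (t + 2) + 8 * A (t + 3) + 4 * A (t + 4) +
    2 * A (t + 5) + A (t + 6)) / 64 = A t := by omega
  have e3 : (64 * A t + 32 * A (t + 1) + 16 * A (t + 2) + 8 * A (t + 3) + 4 * A (t + 4) +
    2 * A (t + 5) + A (t + 6)) / 4 % 2 = A (t + 4) := by omega
  have e4 : (64 * A t + 32 * A (t + 1) + 16 * A (t + 2) + 8 * A (t + 3) + 4 * A (t + 4) +
    2 * A (t + 5) + A (t + 6)) % 2 = A (t + 6) := by omega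
  rw [e1, e3, e4]
  omega

theorem eq_of_modEq {A : ℕ → ℕ} {m : ℕ} (hA : ∀ t, A (t + m) = A t) {s t : ℕ}
    (h : s % m = t % m) : A s = A t := by
  have hp : Function.Periodic A m := hA
  rw [← hp.map_mod_nat s, h, hp.map_mod_nat]

theorem knodelGraph_adj_zero_one {n : ℕ} {i j : Fin (n / 2)} :
    (knodelGraph 4 n).Adj (0, j) (1, i) ↔
      (i : ℕ) = (j + 0) % (n / 2) ∨ (i : ℕ) = (j + 1) % (n / 2) ∨ (i : ℕ) = (j + 3) % (n / 2) ∨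
        (i : ℕ) = (j + 7) % (n / 2) := by
  have h : (knodelGraph 4 n).Adj (0, j) (1, i) ↔
      ∃ k < 4, (i : ℕ) = (j + 2 ^ k - 1) % (n / 2) := by simp [knodelGraph]
  rw [h]
  constructor
  · rintro ⟨k, hk, h⟩
    interval_cases k
    exacts [Or.inl h, Or.inr (Or.inl h), Or.inr (Or.inr (Or.inl h)), Or.inr (Or.inr (Or.inr h))]
  · rintro (h | h | h | h)
    exacts [⟨0, by omega, h⟩, ⟨1, by omega, h⟩, ⟨2, by omega, h⟩, ⟨3, by omega, h⟩]

theorem not_knodelGraph_adj_self {n : ℕ} {i j : Fin (n / 2)} (a : Fin 2) :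
    ¬(knodelGraph 4 n).Adj (a, j) (a, i) := by
  rintro (⟨h0, h1, -⟩ | ⟨h0, h1, -⟩) <;> simp_all

variable {n : ℕ} {D : Finset (Fin 2 × Fin (n / 2))} {A B : ℕ → ℕ}

theorem covers_fst (h : Describes D A B) (j : Fin (n / 2)) :
    (knodelGraph 4 n).Covers D (0, j) ↔
      1 ≤ A j + B j + B (j + 1) + B (j + 3) + B (j + 7) := by
  have hm : 0 < n / 2 := (Nat.zero_le _).trans_lt j.2
  have hex : (∃ v ∈ D, (knodelGraph 4 n).Adj (0, j) v) ↔
      B (j + 0) = 1 ∨ B (j + 1) = 1 ∨ B (j + 3) = 1 ∨ B (j + 7) = 1 := by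
    have hB : ∀ c, (∃ i : Fin (n / 2), B i = 1 ∧ (i : ℕ) = (j + c) % (n / 2)) ↔
        B (j + c) = 1 := by
      intro c
      constructor
      · rintro ⟨i, h1, h2⟩
        rw [← h1]
        exact eq_of_modEq h.snd_periodic (by rw [h2, Nat.mod_mod])
      · intro h1
        refine ⟨⟨(j + c) % (n / 2), Nat.mod_lt _ hm⟩, ?_, rfl⟩
        rw [← h1]
        exact eq_of_modEq h.snd_periodic (Nat.mod_mod _ _)
    rw [← hB 0, ← hB 1, ← hB 3, ← hB 7]
    simp only [Prod.exists, Fin.exists_fin_two, not_knodelGraph_adj_self, and_false, exists_false,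
      false_or, h.mem_snd, knodelGraph_adj_zero_one, and_or_left, exists_or]
  rw [SimpleGraph.Covers, hex, h.mem_fst, Nat.add_zero]
  have := h.fst_le j
  have := h.snd_le j
  have := h.snd_le (j + 1)
  have := h.snd_le (j + 3)
  have := h.snd_le (j + 7)
  omega

/-- Indexing the second part by `t + 7` makes all four neighbours lie at positions from `t` to `t +
7`, without subtraction modulo `n / 2`. -/
theorem covers_snd (h : Describes D A B) {t : ℕ} {j : Fin (n / 2)}
    (hj : (j : ℕ) = (t + 7) % (n / 2)) :
    (knodelGraph 4 n).Covers D (1, j) ↔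
      1 ≤ B (t + 7) + A (t + 7) + A (t + 6) + A (t + 4) + A t := by
  have hm : 0 < n / 2 := (Nat.zero_le _).trans_lt j.2
  have hex : (∃ v ∈ D, (knodelGraph 4 n).Adj (1, j) v) ↔
      A (t + 7) = 1 ∨ A (t + 6) = 1 ∨ A (t + 4) = 1 ∨ A t = 1 := by
    have hA : ∀ c s, s + c = t + 7 →
        ((∃ i : Fin (n / 2), A i = 1 ∧ (j : ℕ) = (i + c) % (n / 2)) ↔ A s = 1) := by
      intro c s hs
      constructor
      · rintro ⟨i, h1, h2⟩
        rw [← h1]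
        rw [hj, ← hs] at h2
        exact eq_of_modEq h.fst_periodic (Nat.ModEq.add_right_cancel' c h2)
      · intro h1
        refine ⟨⟨s % (n / 2), Nat.mod_lt _ hm⟩, ?_, ?_⟩
        · rw [← h1]
          exact eq_of_modEq h.fst_periodic (Nat.mod_mod _ _)
        · rw [hj, ← hs, Nat.mod_add_mod]
    rw [← hA 0 (t + 7) (by omega), ← hA 1 (t + 6) (by omega), ← hA 3 (t + 4) (by omega),
      ← hA 7 t (by omega)]
    simp only [Prod.exists, Fin.exists_fin_two, not_knodelGraph_adj_self, and_false, exists_false,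
      or_false, h.mem_fst, (knodelGraph 4 n).adj_comm (1, j), knodelGraph_adj_zero_one, and_or_left,
      exists_or]
  rw [SimpleGraph.Covers, hex, h.mem_snd,
    eq_of_modEq h.snd_periodic (s := j) (t := t + 7) (by rw [hj, Nat.mod_mod])]
  have := h.snd_le (t + 7)
  have := h.fst_le (t + 7)
  have := h.fst_le (t + 6)
  have := h.fst_le (t + 4)
  have := h.fst_le t
  omega

theorem card_eq_sum {m : ℕ} {D : Finset (Fin 2 × Fin m)} (h : Describes D A B) :
    D.card = ∑ t ∈ Finset.range m, A t + ∑ t ∈ Finset.range m, B t := by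
  classical
  have h1 : D.card = ∑ x : Fin 2 × Fin m, if x ∈ D then 1 else 0 := by simp
  rw [h1, Fintype.sum_prod_type, Fin.sum_univ_two, Finset.sum_range, Finset.sum_range]
  congr 1
  · refine Finset.sum_congr rfl fun j _ => ?_
    have := h.fst_le j
    rw [if_congr (h.mem_fst j) rfl rfl]
    split_ifs <;> omega
  · refine Finset.sum_congr rfl fun j _ => ?_
    have := h.snd_le j
    rw [if_congr (h.mem_snd j) rfl rfl]
    split_ifs <;> omega

/-- Double counting: for a count `c`, `(c - 1) + 1 = c + (1 - c)` with truncated subtraction, and by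
periodicity each of the five shifted sums of `A` and of `B` equals the unshifted one. -/
theorem totalSurplus_add_two_mul {m : ℕ} {D : Finset (Fin 2 × Fin m)} (h : Describes D A B) :
    totalSurplus A B m + 2 * m = 5 * D.card + totalDeficit A B m := by
  have hpt : ∀ t, surplusAt A B t + 2 = (B (t + 7) + A (t + 7) + A (t + 6) + A (t + 4) + A t) +
      (A t + B t + B (t + 1) + B (t + 3) + B (t + 7)) + deficitAt A B t := by
    intro t
    rw [surplusAt_eq, deficitAt_eq, fstCount_window h.fst_le h.snd_le, sndCount_window h.fst_le]
    omega
  have hsum := Finset.sum_congr (rfl : Finset.range m = Finset.range m) fun t _ => hpt t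
  have sA : ∀ c, ∑ t ∈ Finset.range m, A (t + c) = ∑ t ∈ Finset.range m, A t := fun c => by
    simpa only [add_comm] using sum_range_shift h.fst_periodic c
  have sB : ∀ c, ∑ t ∈ Finset.range m, B (t + c) = ∑ t ∈ Finset.range m, B t := fun c => by
    simpa only [add_comm] using sum_range_shift h.snd_periodic c
  simp only [Finset.sum_add_distrib, sA, sB, Finset.sum_const, Finset.card_range,
    smul_eq_mul] at hsum
  rw [card_eq_sum h, totalSurplus, totalDeficit]
  omega

theorem totalDeficit_eq_zero (h : Describes D A B) (hD : ∀ u, (knodelGraph 4 n).Covers D u) :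
    totalDeficit A B (n / 2) = 0 := by
  refine Finset.sum_eq_zero fun t ht => ?_
  have hm : t < n / 2 := Finset.mem_range.1 ht
  have h1 := (covers_fst h ⟨t, hm⟩).1 (hD _)
  have h2 := (covers_snd h (j := ⟨(t + 7) % (n / 2), Nat.mod_lt _ (by omega)⟩) rfl).1 (hD _)
  rw [deficitAt_eq, fstCount_window h.fst_le h.snd_le, sndCount_window h.fst_le]
  simp only at h1
  omega

theorem totalDeficit_le_one (h : Describes D A B) {w : Fin 2 × Fin (n / 2)}
    (hD : ∀ u ≠ w, (knodelGraph 4 n).Covers D u) : totalDeficit A B (n / 2) ≤ 1 := by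
  classical
  obtain ⟨i, j⟩ := w
  have hm : 0 < n / 2 := (Nat.zero_le _).trans_lt j.2
  have hsum : ∀ s, ∑ t ∈ Finset.range (n / 2), (if t = s then 1 else 0) ≤ 1 := by
    intro s
    rw [Finset.sum_ite_eq']
    split_ifs <;> omega
  rcases Fin.exists_fin_two.1 ⟨i, rfl⟩ with rfl | rfl
  · refine (Finset.sum_le_sum fun t ht => ?_).trans (hsum j)
    have ht : t < n / 2 := Finset.mem_range.1 ht
    have h2 := (covers_snd h (j := ⟨(t + 7) % (n / 2), Nat.mod_lt _ hm⟩) rfl).1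
      (hD _ (by simp))
    rw [deficitAt_eq, fstCount_window h.fst_le h.snd_le, sndCount_window h.fst_le]
    split_ifs with htj
    · omega
    · have h1 := (covers_fst h ⟨t, ht⟩).1 (hD _ (by simpa [Fin.ext_iff] using htj))
      simp only at h1
      omega
  -- The index `t` with `t + 7` congruent to `j`; the added multiple of the modulus keeps the
  -- subtraction from truncating.
  · refine (Finset.sum_le_sum fun t ht => ?_).trans (hsum ((j + (n / 2) * 7 - 7) % (n / 2)))
    have ht : t < n / 2 := Finset.mem_range.1 ht
    have h1 := (covers_fst h ⟨t, ht⟩).1 (hD _ (by simp))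
    rw [deficitAt_eq, fstCount_window h.fst_le h.snd_le, sndCount_window h.fst_le]
    simp only at h1
    split_ifs with htj
    · omega
    · have h2 := (covers_snd h (j := ⟨(t + 7) % (n / 2), Nat.mod_lt _ hm⟩) rfl).1
        (hD _ (by
          intro heq
          simp only [Prod.mk.injEq, Fin.ext_iff, true_and] at heq
          apply htj
          have h3 : (t + 7) % (n / 2) = (j + (n / 2) * 7 - 7 + 7) % (n / 2) := by
            rw [heq, Nat.sub_add_cancel (by omega), Nat.add_mul_mod_self_left,
              Nat.mod_eq_of_lt j.2]
          have h4 : t % (n / 2) = (j + (n / 2) * 7 - 7) % (n / 2) :=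
            Nat.ModEq.add_right_cancel' 7 h3
          rwa [Nat.mod_eq_of_lt ht] at h4))
      omega

/-! ### Lower bounds and criteria for stability -/

theorem lt_card_of_isDominatingSet {P m₀ : ℕ} {goal : ℕ → Bool}
    (hsearch : loopSearch P 0 m₀ goal = true) (hm₀ : m₀ ≤ n / 2) (hgoal : goal (n / 2) = true)
    (hPm : P < m₀) (hP : P ≤ 7) (hcost : P < shiftCost 0 (n / 2 % 5))
    (hD : (knodelGraph 4 n).IsDominatingSet D) : P + 2 * (n / 2) < 5 * D.card := by
  obtain ⟨A, B, h⟩ := exists_describes (by omega) D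
  have hdef := totalDeficit_eq_zero h (SimpleGraph.isDominatingSet_iff.1 hD)
  have hsum := totalSurplus_add_two_mul h
  have := not_surplus_le (by omega) h.fst_le h.snd_le h.fst_periodic h.snd_periodic hsearch hm₀
    hgoal hPm hP (by omega) (fun d hd => by rwa [Nat.le_zero.1 hd]) hdef.le
  omega

theorem lt_card_of_covers_ne {P m₀ : ℕ} {goal : ℕ → Bool}
    (hsearch : loopSearch P 1 m₀ goal = true) (hm₀ : m₀ ≤ n / 2) (hgoal : goal (n / 2) = true)
    (hPm : P + 1 < m₀) (hP : P ≤ 5) (hcost : ∀ d ≤ 1, P < shiftCost d (n / 2 % 5))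
    {w : Fin 2 × Fin (n / 2)} (hD : ∀ u ≠ w, (knodelGraph 4 n).Covers D u) :
    P + 2 * (n / 2) ≤ 5 * D.card := by
  obtain ⟨A, B, h⟩ := exists_describes (by omega) D
  have hdef := totalDeficit_le_one h hD
  have hsum := totalSurplus_add_two_mul h
  have := not_surplus_le (by omega) h.fst_le h.snd_le h.fst_periodic h.snd_periodic hsearch hm₀
    hgoal hPm (by omega) le_rfl hcost hdef
  omega

theorem two_mul_le_card_of_covers_ne {w : Fin 2 × Fin (n / 2)}
    (hD : ∀ u ≠ w, (knodelGraph 4 n).Covers D u) : 2 * (n / 2) ≤ 5 * D.card + 1 := by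
  obtain ⟨A, B, h⟩ := exists_describes ((Nat.zero_le _).trans_lt w.2.2) D
  have hdef := totalDeficit_le_one h hD
  have hsum := totalSurplus_add_two_mul h
  omega

theorem isDominatingSet_of_describes {A B : ℕ → ℕ} (h : Describes D A B)
    (hfst : ∀ t, 1 ≤ A t + B t + B (t + 1) + B (t + 3) + B (t + 7))
    (hsnd : ∀ t, 1 ≤ B (t + 7) + A (t + 7) + A (t + 6) + A (t + 4) + A t) :
    (knodelGraph 4 n).IsDominatingSet D := by
  refine SimpleGraph.isDominatingSet_iff.2 ?_
  rintro ⟨i, j⟩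
  have hm : 0 < n / 2 := (Nat.zero_le _).trans_lt j.2
  rcases Fin.exists_fin_two.1 ⟨i, rfl⟩ with rfl | rfl
  · exact (covers_fst h j).2 (hfst j)
  · refine (covers_snd h (t := j + n / 2 * 7 - 7) ?_).2 (hsnd _)
    rw [Nat.sub_add_cancel (by omega), Nat.add_mul_mod_self_left, Nat.mod_eq_of_lt j.2]

theorem fst_pos_of_isDominatingSet {A B : ℕ → ℕ} (h : Describes D A B) (hm : 0 < n / 2)
    (hD : (knodelGraph 4 n).IsDominatingSet D) (t : ℕ) :
    1 ≤ A t + B t + B (t + 1) + B (t + 3) + B (t + 7) := by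
  have h1 := (covers_fst h ⟨t % (n / 2), Nat.mod_lt _ hm⟩).1
    (SimpleGraph.isDominatingSet_iff.1 hD _)
  have hB : ∀ c, B (t % (n / 2) + c) = B (t + c) := fun c =>
    eq_of_modEq h.snd_periodic (Nat.mod_add_mod _ _ _)
  rw [hB, hB, hB, eq_of_modEq h.fst_periodic (Nat.mod_mod t _),
    eq_of_modEq h.snd_periodic (Nat.mod_mod t _)] at h1
  exact h1

/-- Rotations preserve domination. With fewer than `n / 2` members, `D` misses a position in each
part, and a rotation moves that position to `w`. -/
theorem exists_isDominatingSet_notMem (hD : (knodelGraph 4 n).IsDominatingSet D)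
    (hcard : D.card < n / 2) (w : Fin 2 × Fin (n / 2)) :
    ∃ D' : Finset (Fin 2 × Fin (n / 2)), (knodelGraph 4 n).IsDominatingSet D' ∧
      D'.card = D.card ∧ w ∉ D' := by
  obtain ⟨i, j⟩ := w
  have hm : 0 < n / 2 := (Nat.zero_le _).trans_lt j.2
  obtain ⟨A, B, h⟩ := exists_describes hm D
  have hfst := fst_pos_of_isDominatingSet h hm hD
  have hsnd : ∀ t, 1 ≤ B (t + 7) + A (t + 7) + A (t + 6) + A (t + 4) + A t := fun t =>
    (covers_snd h (j := ⟨(t + 7) % (n / 2), Nat.mod_lt _ hm⟩) rfl).1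
      (SimpleGraph.isDominatingSet_iff.1 hD _)
  have hsum := card_eq_sum h
  have hzero : ∀ C : ℕ → ℕ, (∀ t, C (t + n / 2) = C t) →
      ∑ t ∈ Finset.range (n / 2), C t < n / 2 → ∃ s, C (s + j) = 0 := by
    intro C hC hlt
    by_contra! hne
    have : ∑ t ∈ Finset.range (n / 2), 1 ≤ ∑ t ∈ Finset.range (n / 2), C t :=
      Finset.sum_le_sum fun t _ => by
        have := hne (t + n / 2 - j)
        rw [Nat.sub_add_cancel (by omega), hC] at this
        omega
    simp at this
    omega
  have hshift : ∀ s, ∃ D' : Finset (Fin 2 × Fin (n / 2)),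
      Describes D' (fun t => A (s + t)) (fun t => B (s + t)) ∧
      (knodelGraph 4 n).IsDominatingSet D' ∧ D'.card = D.card := by
    intro s
    have h' := describes_filter (m := n / 2) (A := fun t => A (s + t)) (B := fun t => B (s + t))
      (fun _ => h.fst_le _) (fun _ => h.snd_le _) (periodic_shift h.fst_periodic s)
      (periodic_shift h.snd_periodic s)
    refine ⟨_, h', isDominatingSet_of_describes h' (fun t => hfst (s + t))
      (fun t => hsnd (s + t)), ?_⟩
    rw [card_eq_sum h', sum_range_shift h.fst_periodic, sum_range_shift h.snd_periodic, hsum]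
  rcases Fin.exists_fin_two.1 ⟨i, rfl⟩ with rfl | rfl
  · obtain ⟨s, hs⟩ := hzero A h.fst_periodic (by omega)
    obtain ⟨D', h', hdom, hc⟩ := hshift s
    exact ⟨D', hdom, hc, by rw [h'.mem_fst, hs]; exact zero_ne_one⟩
  · obtain ⟨s, hs⟩ := hzero B h.snd_periodic (by omega)
    obtain ⟨D', h', hdom, hc⟩ := hshift s
    exact ⟨D', hdom, hc, by rw [h'.mem_snd, hs]; exact zero_ne_one⟩

theorem isDominationStable_of_le {k : ℕ} (hk : k < n / 2)
    (hD : (knodelGraph 4 n).IsDominatingSet D) (hcard : D.card ≤ k)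
    (hlow : ∀ (w : Fin 2 × Fin (n / 2)) (E : Finset (Fin 2 × Fin (n / 2))),
      (∀ u ≠ w, (knodelGraph 4 n).Covers E u) → k ≤ E.card) :
    (knodelGraph 4 n).IsDominationStable := by
  have hle : ∀ E : Finset (Fin 2 × Fin (n / 2)), (knodelGraph 4 n).IsDominatingSet E →
      k ≤ E.card := fun E hE =>
    hlow (0, ⟨0, by omega⟩) E fun u _ => SimpleGraph.isDominatingSet_iff.1 hE u
  have hγ : (knodelGraph 4 n).dominationNumber = k := by
    refine le_antisymm (SimpleGraph.dominationNumber_le_iff.2 ⟨D, hD, hcard⟩) ?_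
    obtain ⟨E, hE, hc⟩ := SimpleGraph.dominationNumber_le_iff.1
      (le_refl (knodelGraph 4 n).dominationNumber)
    exact (hle E hE).trans hc
  intro w
  rw [hγ]
  apply le_antisymm
  · obtain ⟨D', hD', hc, hw⟩ := exists_isDominatingSet_notMem hD (by omega) w
    exact SimpleGraph.removeVertex_dominationNumber_le_iff.2
      ⟨D', hw, fun u _ => SimpleGraph.isDominatingSet_iff.1 hD' u, by omega⟩
  · obtain ⟨E, -, hE, hc⟩ := SimpleGraph.removeVertex_dominationNumber_le_iff.1
      (le_refl ((knodelGraph 4 n).removeVertex w).dominationNumber)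
    exact (hlow w E hE).trans hc

theorem not_isDominationStable_of_lt {k : ℕ} {w : Fin 2 × Fin (n / 2)}
    (hD : ∀ u ≠ w, (knodelGraph 4 n).Covers D u) (hcard : D.card ≤ k)
    (hlow : ∀ E : Finset (Fin 2 × Fin (n / 2)), (knodelGraph 4 n).IsDominatingSet E →
      k < E.card) : ¬(knodelGraph 4 n).IsDominationStable := by
  intro hst
  have hw : w ∉ D := by
    intro hw
    -- A set containing `w` and covering all other vertices would dominate the whole graph, against
    -- `hlow`.
    refine absurd (hlow D (SimpleGraph.isDominatingSet_iff.2 fun u => ?_)) (by omega)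
    by_cases huw : u = w
    · exact Or.inl (huw ▸ hw)
    · exact hD u huw
  have h1 := SimpleGraph.removeVertex_dominationNumber_le_iff.2 ⟨D, hw, hD, hcard⟩
  rw [hst w] at h1
  obtain ⟨E, hE, hc⟩ := SimpleGraph.dominationNumber_le_iff.1 h1
  exact absurd (hlow E hE) (by omega)

/-! ### Explicit sets built from the efficient pattern -/

/-- The set of vertices whose positions satisfy `α` in the first part and `β` in the second. -/
def patternSet (m : ℕ) (α β : ℕ → Prop) [DecidablePred α] [DecidablePred β] :
    Finset (Fin 2 × Fin m) :=
  Finset.univ.filter fun x => x.1 = 0 ∧ α x.2 ∨ x.1 = 1 ∧ β x.2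

variable {α β : ℕ → Prop} [DecidablePred α] [DecidablePred β]

theorem describes_patternSet (m : ℕ) : Describes (patternSet m α β)
    (fun t => if α (t % m) then 1 else 0) (fun t => if β (t % m) then 1 else 0) := by
  refine ⟨fun t => ?_, fun t => ?_, fun t => ?_, fun t => ?_, fun j => ?_, fun j => ?_⟩
  · split_ifs <;> omega
  · split_ifs <;> omega
  · simp only [Nat.add_mod_right]
  · simp only [Nat.add_mod_right]
  · simp [patternSet, Nat.mod_eq_of_lt j.2]
  · simp [patternSet, Nat.mod_eq_of_lt j.2]

theorem patternSet_covers_fst {j : Fin (n / 2)}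
    (h : α j ∨ β j ∨ β ((j + 1) % (n / 2)) ∨ β ((j + 3) % (n / 2)) ∨ β ((j + 7) % (n / 2))) :
    (knodelGraph 4 n).Covers (patternSet (n / 2) α β) (0, j) := by
  rw [covers_fst (describes_patternSet _)]
  simp only [Nat.mod_eq_of_lt j.2]
  split_ifs <;> first | omega | tauto

theorem patternSet_covers_snd {t : ℕ} {j : Fin (n / 2)} (ht : t < n / 2)
    (hj : (j : ℕ) = (t + 7) % (n / 2))
    (h : β ((t + 7) % (n / 2)) ∨ α ((t + 7) % (n / 2)) ∨ α ((t + 6) % (n / 2)) ∨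
      α ((t + 4) % (n / 2)) ∨ α t) :
    (knodelGraph 4 n).Covers (patternSet (n / 2) α β) (1, j) := by
  rw [covers_snd (describes_patternSet _) hj]
  simp only [Nat.mod_eq_of_lt ht]
  split_ifs <;> first | omega | tauto

theorem patternSet_covers (P : Fin 2 × Fin (n / 2) → Prop)
    (hfst : ∀ t (ht : t < n / 2), P (0, ⟨t, ht⟩) → α t ∨ β t ∨ β ((t + 1) % (n / 2)) ∨
      β ((t + 3) % (n / 2)) ∨ β ((t + 7) % (n / 2)))
    (hsnd : ∀ t (ht : t < n / 2), P (1, ⟨(t + 7) % (n / 2), Nat.mod_lt _ (by omega)⟩) →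
      β ((t + 7) % (n / 2)) ∨ α ((t + 7) % (n / 2)) ∨ α ((t + 6) % (n / 2)) ∨
      α ((t + 4) % (n / 2)) ∨ α t) (u : Fin 2 × Fin (n / 2)) (hu : P u) :
    (knodelGraph 4 n).Covers (patternSet (n / 2) α β) u := by
  obtain ⟨i, j⟩ := u
  have hm : 0 < n / 2 := (Nat.zero_le _).trans_lt j.2
  rcases Fin.exists_fin_two.1 ⟨i, rfl⟩ with rfl | rfl
  · exact patternSet_covers_fst (hfst j j.2 hu)
  · have hj : (j : ℕ) = ((j + n / 2 * 7 - 7) % (n / 2) + 7) % (n / 2) := by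
      rw [Nat.mod_add_mod, Nat.sub_add_cancel (by omega), Nat.add_mul_mod_self_left,
        Nat.mod_eq_of_lt j.2]
    have hj' : j = ⟨((j + n / 2 * 7 - 7) % (n / 2) + 7) % (n / 2), Nat.mod_lt _ hm⟩ := Fin.ext hj
    exact patternSet_covers_snd (Nat.mod_lt _ hm) hj
      (hsnd _ (Nat.mod_lt _ hm) (by rwa [← hj']))

theorem card_patternSet (m : ℕ) : (patternSet m α β).card =
    ((Finset.range m).filter α).card + ((Finset.range m).filter β).card := by
  rw [card_eq_sum (describes_patternSet m), Finset.card_filter, Finset.card_filter]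
  congr 1 <;> refine Finset.sum_congr rfl fun t ht => ?_ <;>
    rw [Nat.mod_eq_of_lt (Finset.mem_range.1 ht)]

/-- Meant for patterns that are periodic on the first `k` blocks of length five; `l` lists the
positions in the irregular last block. -/
theorem card_filter_range_le {m c k : ℕ} (l : List ℕ)
    (h : ∀ t < m, α t → t % 5 = c ∧ t < 5 * k ∨ t ∈ l) :
    ((Finset.range m).filter α).card ≤ k + l.length := by
  have hsub : (Finset.range m).filter α ⊆
      (Finset.range k).image (fun i => 5 * i + c) ∪ l.toFinset := by
    intro t ht
    rw [Finset.mem_filter, Finset.mem_range] at ht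
    rcases h t ht.1 ht.2 with h | h
    · exact Finset.mem_union_left _ (Finset.mem_image.2
        ⟨t / 5, Finset.mem_range.2 (by omega), by omega⟩)
    · exact Finset.mem_union_right _ (List.mem_toFinset.2 h)
  refine (Finset.card_le_card hsub).trans ((Finset.card_union_le _ _).trans ?_)
  refine Nat.add_le_add (Finset.card_image_le.trans (Finset.card_range k).le) l.toFinset_card_le

/-- `x`, `y`, `z` are the residues of `t + 1`, `t + 3`, `t + 7` modulo `m`. -/
def FstWrap (m t x y z : ℕ) : Prop :=
  t + 7 < m ∧ x = t + 1 ∧ y = t + 3 ∧ z = t + 7 ∨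
  t + 7 = m ∧ x = t + 1 ∧ y = t + 3 ∧ z = 0 ∨
  t + 6 = m ∧ x = t + 1 ∧ y = t + 3 ∧ z = 1 ∨
  t + 5 = m ∧ x = t + 1 ∧ y = t + 3 ∧ z = 2 ∨
  t + 4 = m ∧ x = t + 1 ∧ y = t + 3 ∧ z = 3 ∨
  t + 3 = m ∧ x = t + 1 ∧ y = 0 ∧ z = 4 ∨
  t + 2 = m ∧ x = t + 1 ∧ y = 1 ∧ z = 5 ∨
  t + 1 = m ∧ x = 0 ∧ y = 2 ∧ z = 6

/-- `x`, `y`, `z` are the residues of `t + 4`, `t + 6`, `t + 7` modulo `m`. -/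
def SndWrap (m t x y z : ℕ) : Prop :=
  t + 7 < m ∧ x = t + 4 ∧ y = t + 6 ∧ z = t + 7 ∨
  t + 7 = m ∧ x = t + 4 ∧ y = t + 6 ∧ z = 0 ∨
  t + 6 = m ∧ x = t + 4 ∧ y = 0 ∧ z = 1 ∨
  t + 5 = m ∧ x = t + 4 ∧ y = 1 ∧ z = 2 ∨
  t + 4 = m ∧ x = 0 ∧ y = 2 ∧ z = 3 ∨
  t + 3 = m ∧ x = 1 ∧ y = 3 ∧ z = 4 ∨
  t + 2 = m ∧ x = 2 ∧ y = 4 ∧ z = 5 ∨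
  t + 1 = m ∧ x = 3 ∧ y = 5 ∧ z = 6

theorem add_mod_of_lt {m t c : ℕ} (ht : t < m) (hc : c ≤ m) :
    t + c < m ∧ (t + c) % m = t + c ∨ m ≤ t + c ∧ (t + c) % m + m = t + c := by
  rcases lt_or_ge (t + c) m with h | h
  · exact Or.inl ⟨h, Nat.mod_eq_of_lt h⟩
  · have : (t + c) % m = t + c - m := by
      rw [Nat.mod_eq_sub_mod h, Nat.mod_eq_of_lt (by omega)]
    omega

/-- Reduction modulo a variable becomes eight cases of linear arithmetic, since only the last seven
positions wrap around. -/
theorem fstWrap_mod {m t : ℕ} (hm : 8 ≤ m) (ht : t < m) :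
    FstWrap m t ((t + 1) % m) ((t + 3) % m) ((t + 7) % m) := by
  have h1 := add_mod_of_lt ht (c := 1) (by omega)
  have h3 := add_mod_of_lt ht (c := 3) (by omega)
  have h7 := add_mod_of_lt ht (c := 7) (by omega)
  unfold FstWrap
  generalize (t + 1) % m = x at *
  generalize (t + 3) % m = y at *
  generalize (t + 7) % m = z at *
  rcases (by omega : t + 7 < m ∨ t + 7 = m ∨ t + 6 = m ∨ t + 5 = m ∨ t + 4 = m ∨ t + 3 = m ∨
    t + 2 = m ∨ t + 1 = m) with h | h | h | h | h | h | h | h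
  · exact Or.inl ⟨h, by omega, by omega, by omega⟩
  · exact Or.inr <| Or.inl ⟨h, by omega, by omega, by omega⟩
  · exact Or.inr <| Or.inr <| Or.inl ⟨h, by omega, by omega, by omega⟩
  · exact Or.inr <| Or.inr <| Or.inr <| Or.inl ⟨h, by omega, by omega, by omega⟩
  · exact Or.inr <| Or.inr <| Or.inr <| Or.inr <| Or.inl ⟨h, by omega, by omega, by omega⟩
  · exact Or.inr <| Or.inr <| Or.inr <| Or.inr <| Or.inr <| Or.inl ⟨h, by omega, by omega, by omega⟩
  · exact Or.inr <| Or.inr <| Or.inr <| Or.inr <| Or.inr <| Or.inr <| Or.inl ⟨h, by omega, by omega, by omega⟩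
  · exact Or.inr <| Or.inr <| Or.inr <| Or.inr <| Or.inr <| Or.inr <| Or.inr <| ⟨h, by omega, by omega, by omega⟩

theorem sndWrap_mod {m t : ℕ} (hm : 8 ≤ m) (ht : t < m) :
    SndWrap m t ((t + 4) % m) ((t + 6) % m) ((t + 7) % m) := by
  have h1 := add_mod_of_lt ht (c := 4) (by omega)
  have h3 := add_mod_of_lt ht (c := 6) (by omega)
  have h7 := add_mod_of_lt ht (c := 7) (by omega)
  unfold SndWrap
  generalize (t + 4) % m = x at *
  generalize (t + 6) % m = y at *
  generalize (t + 7) % m = z at *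
  rcases (by omega : t + 7 < m ∨ t + 7 = m ∨ t + 6 = m ∨ t + 5 = m ∨ t + 4 = m ∨ t + 3 = m ∨
    t + 2 = m ∨ t + 1 = m) with h | h | h | h | h | h | h | h
  · exact Or.inl ⟨h, by omega, by omega, by omega⟩
  · exact Or.inr <| Or.inl ⟨h, by omega, by omega, by omega⟩
  · exact Or.inr <| Or.inr <| Or.inl ⟨h, by omega, by omega, by omega⟩
  · exact Or.inr <| Or.inr <| Or.inr <| Or.inl ⟨h, by omega, by omega, by omega⟩
  · exact Or.inr <| Or.inr <| Or.inr <| Or.inr <| Or.inl ⟨h, by omega, by omega, by omega⟩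
  · exact Or.inr <| Or.inr <| Or.inr <| Or.inr <| Or.inr <| Or.inl ⟨h, by omega, by omega, by omega⟩
  · exact Or.inr <| Or.inr <| Or.inr <| Or.inr <| Or.inr <| Or.inr <| Or.inl ⟨h, by omega, by omega, by omega⟩
  · exact Or.inr <| Or.inr <| Or.inr <| Or.inr <| Or.inr <| Or.inr <| Or.inr <| ⟨h, by omega, by omega, by omega⟩

/-- A pattern covers all vertices of the first part outside `e`, and all vertices of the second
part except those at position `t + 7` with `f t`. -/
theorem patternSet_covers_of_wrap (hm : 8 ≤ n / 2) (e f : ℕ → Prop)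
    (hfst : ∀ t x y z, FstWrap (n / 2) t x y z → e t ∨ α t ∨ β t ∨ β x ∨ β y ∨ β z)
    (hsnd : ∀ t x y z, SndWrap (n / 2) t x y z → f t ∨ β z ∨ α z ∨ α y ∨ α x ∨ α t)
    (u : Fin 2 × Fin (n / 2)) (hu : u.1 = 0 → ¬e u.2)
    (hu' : u.1 = 1 → ∀ t < n / 2, (t + 7) % (n / 2) = u.2 → ¬f t) :
    (knodelGraph 4 n).Covers (patternSet (n / 2) α β) u :=
  patternSet_covers (fun u => (u.1 = 0 → ¬e u.2) ∧
      (u.1 = 1 → ∀ t < n / 2, (t + 7) % (n / 2) = u.2 → ¬f t))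
    (fun t ht h => (hfst t _ _ _ (fstWrap_mod hm ht)).resolve_left (h.1 rfl))
    (fun t ht h => (hsnd t _ _ _ (sndWrap_mod hm ht)).resolve_left (h.2 rfl t ht rfl)) u ⟨hu, hu'⟩

theorem patternSet_isDominatingSet (hm : 8 ≤ n / 2)
    (hfst : ∀ t x y z, FstWrap (n / 2) t x y z → α t ∨ β t ∨ β x ∨ β y ∨ β z)
    (hsnd : ∀ t x y z, SndWrap (n / 2) t x y z → β z ∨ α z ∨ α y ∨ α x ∨ α t) :
    (knodelGraph 4 n).IsDominatingSet (patternSet (n / 2) α β) :=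
  SimpleGraph.isDominatingSet_iff.2 fun u =>
    patternSet_covers_of_wrap hm (fun _ => False) (fun _ => False)
      (fun t x y z h => Or.inr (hfst t x y z h)) (fun t x y z h => Or.inr (hsnd t x y z h)) u
      (fun _ => id) fun _ _ _ _ => id

theorem patternSet_covers_ne_fst (hm : 8 ≤ n / 2) (j : Fin (n / 2))
    (hfst : ∀ t x y z, FstWrap (n / 2) t x y z → t = j ∨ α t ∨ β t ∨ β x ∨ β y ∨ β z)
    (hsnd : ∀ t x y z, SndWrap (n / 2) t x y z → β z ∨ α z ∨ α y ∨ α x ∨ α t) :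
    ∀ u ≠ (0, j), (knodelGraph 4 n).Covers (patternSet (n / 2) α β) u := fun u hu =>
  patternSet_covers_of_wrap hm (fun t => t = j) (fun _ => False) hfst
    (fun t x y z h => Or.inr (hsnd t x y z h)) u
    (fun h0 hj => hu (Prod.ext h0 (Fin.ext hj))) fun _ _ _ _ => id

theorem patternSet_covers_ne_snd (hm : 8 ≤ n / 2)
    (hfst : ∀ t x y z, FstWrap (n / 2) t x y z → α t ∨ β t ∨ β x ∨ β y ∨ β z)
    (hsnd : ∀ t x y z, SndWrap (n / 2) t x y z →
      t + 7 = n / 2 ∨ β z ∨ α z ∨ α y ∨ α x ∨ α t) :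
    ∀ u ≠ (1, ⟨0, by omega⟩), (knodelGraph 4 n).Covers (patternSet (n / 2) α β) u := fun u hu =>
  patternSet_covers_of_wrap hm (fun _ => False) (fun t => t + 7 = n / 2)
    (fun t x y z h => Or.inr (hfst t x y z h)) hsnd u (fun _ => id)
    fun h1 t _ hj hf => hu (Prod.ext h1 (Fin.ext (by rw [← hj, hf, Nat.mod_self])))

theorem card_patternSet_le {m c d k : ℕ} (l l' : List ℕ)
    (hα : ∀ t < m, α t → t % 5 = c ∧ t < 5 * k ∨ t ∈ l)
    (hβ : ∀ t < m, β t → t % 5 = d ∧ t < 5 * k ∨ t ∈ l') :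
    (patternSet m α β).card ≤ 2 * k + l.length + l'.length := by
  have h1 := card_filter_range_le l hα
  have h2 := card_filter_range_le l' hβ
  rw [card_patternSet]
  omega

theorem exists_dominating_zero (hm : 8 ≤ n / 2) (hr : n / 2 % 5 = 0) :
    ∃ D, (knodelGraph 4 n).IsDominatingSet D ∧ D.card ≤ 2 * (n / 2 / 5) := by
  refine ⟨patternSet (n / 2) (fun t => t % 5 = 3) (fun t => t % 5 = 2),
    patternSet_isDominatingSet hm ?_ ?_, ?_⟩
  · rintro t x y z (⟨h, rfl, rfl, rfl⟩ | ⟨h, rfl, rfl, rfl⟩ | ⟨h, rfl, rfl, rfl⟩ |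
      ⟨h, rfl, rfl, rfl⟩ | ⟨h, rfl, rfl, rfl⟩ | ⟨h, rfl, rfl, rfl⟩ | ⟨h, rfl, rfl, rfl⟩ |
      ⟨h, rfl, rfl, rfl⟩) <;> omega
  · rintro t x y z (⟨h, rfl, rfl, rfl⟩ | ⟨h, rfl, rfl, rfl⟩ | ⟨h, rfl, rfl, rfl⟩ |
      ⟨h, rfl, rfl, rfl⟩ | ⟨h, rfl, rfl, rfl⟩ | ⟨h, rfl, rfl, rfl⟩ | ⟨h, rfl, rfl, rfl⟩ |
      ⟨h, rfl, rfl, rfl⟩) <;> omega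
  · exact card_patternSet_le (c := 3) (d := 2) (k := n / 2 / 5) [] []
      (fun t _ h => by omega) (fun t _ h => by omega)

/-- Here and for the residues 2, 3, 4, the efficient pattern fills all blocks but the last, which is
lengthened to `5 + n / 2 % 5` positions and filled by hand. Surplus 4 and deficit 1 realise the
cheapest shift by one phase. -/
theorem exists_covers_ne_one (hm : 11 ≤ n / 2) (hr : n / 2 % 5 = 1) :
    ∃ D, (∀ u ≠ (1, ⟨0, by omega⟩), (knodelGraph 4 n).Covers D u) ∧
      D.card ≤ 2 * (n / 2 / 5) + 1 := by
  refine ⟨patternSet (n / 2) (fun t => t % 5 = 3 ∧ t + 4 < n / 2 ∨ t + 2 = n / 2)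
    (fun t => t % 5 = 2 ∧ t + 4 < n / 2 ∨ t + 4 = n / 2 ∨ t + 3 = n / 2),
    patternSet_covers_ne_snd (by omega) ?_ ?_, ?_⟩
  · rintro t x y z (⟨h, rfl, rfl, rfl⟩ | ⟨h, rfl, rfl, rfl⟩ | ⟨h, rfl, rfl, rfl⟩ |
      ⟨h, rfl, rfl, rfl⟩ | ⟨h, rfl, rfl, rfl⟩ | ⟨h, rfl, rfl, rfl⟩ | ⟨h, rfl, rfl, rfl⟩ |
      ⟨h, rfl, rfl, rfl⟩) <;> omega
  · rintro t x y z (⟨h, rfl, rfl, rfl⟩ | ⟨h, rfl, rfl, rfl⟩ | ⟨h, rfl, rfl, rfl⟩ |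
      ⟨h, rfl, rfl, rfl⟩ | ⟨h, rfl, rfl, rfl⟩ | ⟨h, rfl, rfl, rfl⟩ | ⟨h, rfl, rfl, rfl⟩ |
      ⟨h, rfl, rfl, rfl⟩) <;> omega
  · refine (card_patternSet_le (c := 3) (d := 2) (k := n / 2 / 5 - 1) [n / 2 - 2]
      [n / 2 - 4, n / 2 - 3] (fun t _ h => ?_) (fun t _ h => ?_)).trans ?_
    · simp only [List.mem_cons, List.not_mem_nil, or_false]; omega
    · simp only [List.mem_cons, List.not_mem_nil, or_false]; omega
    · simp only [List.length_cons, List.length_nil]; omega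

theorem exists_dominating_two (hm : 12 ≤ n / 2) (hr : n / 2 % 5 = 2) :
    ∃ D, (knodelGraph 4 n).IsDominatingSet D ∧ D.card ≤ 2 * (n / 2 / 5) + 2 := by
  refine ⟨patternSet (n / 2)
    (fun t => t % 5 = 3 ∧ t + 5 < n / 2 ∨ t + 3 = n / 2 ∨ t + 2 = n / 2)
    (fun t => t % 5 = 2 ∧ t + 5 < n / 2 ∨ t + 5 = n / 2 ∨ t + 4 = n / 2),
    patternSet_isDominatingSet (by omega) ?_ ?_, ?_⟩
  · rintro t x y z (⟨h, rfl, rfl, rfl⟩ | ⟨h, rfl, rfl, rfl⟩ | ⟨h, rfl, rfl, rfl⟩ |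
      ⟨h, rfl, rfl, rfl⟩ | ⟨h, rfl, rfl, rfl⟩ | ⟨h, rfl, rfl, rfl⟩ | ⟨h, rfl, rfl, rfl⟩ |
      ⟨h, rfl, rfl, rfl⟩) <;> omega
  · rintro t x y z (⟨h, rfl, rfl, rfl⟩ | ⟨h, rfl, rfl, rfl⟩ | ⟨h, rfl, rfl, rfl⟩ |
      ⟨h, rfl, rfl, rfl⟩ | ⟨h, rfl, rfl, rfl⟩ | ⟨h, rfl, rfl, rfl⟩ | ⟨h, rfl, rfl, rfl⟩ |
      ⟨h, rfl, rfl, rfl⟩) <;> omega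
  · refine (card_patternSet_le (c := 3) (d := 2) (k := n / 2 / 5 - 1) [n / 2 - 3, n / 2 - 2]
      [n / 2 - 5, n / 2 - 4] (fun t _ h => ?_) (fun t _ h => ?_)).trans ?_
    · simp only [List.mem_cons, List.not_mem_nil, or_false]; omega
    · simp only [List.mem_cons, List.not_mem_nil, or_false]; omega
    · simp only [List.length_cons, List.length_nil]; omega

theorem exists_dominating_three (hm : 13 ≤ n / 2) (hr : n / 2 % 5 = 3) :
    ∃ D, (knodelGraph 4 n).IsDominatingSet D ∧ D.card ≤ 2 * (n / 2 / 5) + 3 := by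
  refine ⟨patternSet (n / 2)
    (fun t => t % 5 = 3 ∧ t + 6 < n / 2 ∨ t + 4 = n / 2 ∨ t + 3 = n / 2 ∨ t + 2 = n / 2)
    (fun t => t % 5 = 2 ∧ t + 6 < n / 2 ∨ t + 6 = n / 2 ∨ t + 5 = n / 2),
    patternSet_isDominatingSet (by omega) ?_ ?_, ?_⟩
  · rintro t x y z (⟨h, rfl, rfl, rfl⟩ | ⟨h, rfl, rfl, rfl⟩ | ⟨h, rfl, rfl, rfl⟩ |
      ⟨h, rfl, rfl, rfl⟩ | ⟨h, rfl, rfl, rfl⟩ | ⟨h, rfl, rfl, rfl⟩ | ⟨h, rfl, rfl, rfl⟩ |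
      ⟨h, rfl, rfl, rfl⟩) <;> omega
  · rintro t x y z (⟨h, rfl, rfl, rfl⟩ | ⟨h, rfl, rfl, rfl⟩ | ⟨h, rfl, rfl, rfl⟩ |
      ⟨h, rfl, rfl, rfl⟩ | ⟨h, rfl, rfl, rfl⟩ | ⟨h, rfl, rfl, rfl⟩ | ⟨h, rfl, rfl, rfl⟩ |
      ⟨h, rfl, rfl, rfl⟩) <;> omega
  · refine (card_patternSet_le (c := 3) (d := 2) (k := n / 2 / 5 - 1)
      [n / 2 - 4, n / 2 - 3, n / 2 - 2] [n / 2 - 6, n / 2 - 5] (fun t _ h => ?_)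
      (fun t _ h => ?_)).trans ?_
    · simp only [List.mem_cons, List.not_mem_nil, or_false]; omega
    · simp only [List.mem_cons, List.not_mem_nil, or_false]; omega
    · simp only [List.length_cons, List.length_nil]; omega

/-- The omitted vertex is the first position of the last block, which has length nine. -/
theorem exists_covers_ne_four (hm : 14 ≤ n / 2) (hr : n / 2 % 5 = 4) :
    ∃ D, (∀ u ≠ (0, ⟨n / 2 - 9, by omega⟩), (knodelGraph 4 n).Covers D u) ∧
      D.card ≤ 2 * (n / 2 / 5) + 3 := by
  refine ⟨patternSet (n / 2)
    (fun t => t % 5 = 3 ∧ t + 7 < n / 2 ∨ t + 6 = n / 2 ∨ t + 2 = n / 2 ∨ t + 1 = n / 2)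
    (fun t => t % 5 = 2 ∧ t + 7 < n / 2 ∨ t + 7 = n / 2 ∨ t + 3 = n / 2),
    patternSet_covers_ne_fst (by omega) _ ?_ ?_, ?_⟩
  · rintro t x y z (⟨h, rfl, rfl, rfl⟩ | ⟨h, rfl, rfl, rfl⟩ | ⟨h, rfl, rfl, rfl⟩ |
      ⟨h, rfl, rfl, rfl⟩ | ⟨h, rfl, rfl, rfl⟩ | ⟨h, rfl, rfl, rfl⟩ | ⟨h, rfl, rfl, rfl⟩ |
      ⟨h, rfl, rfl, rfl⟩) <;> dsimp only <;> omega
  · rintro t x y z (⟨h, rfl, rfl, rfl⟩ | ⟨h, rfl, rfl, rfl⟩ | ⟨h, rfl, rfl, rfl⟩ |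
      ⟨h, rfl, rfl, rfl⟩ | ⟨h, rfl, rfl, rfl⟩ | ⟨h, rfl, rfl, rfl⟩ | ⟨h, rfl, rfl, rfl⟩ |
      ⟨h, rfl, rfl, rfl⟩) <;> omega
  · refine (card_patternSet_le (c := 3) (d := 2) (k := n / 2 / 5 - 1)
      [n / 2 - 6, n / 2 - 2, n / 2 - 1] [n / 2 - 7, n / 2 - 3] (fun t _ h => ?_)
      (fun t _ h => ?_)).trans ?_
    · simp only [List.mem_cons, List.not_mem_nil, or_false]; omega
    · simp only [List.mem_cons, List.not_mem_nil, or_false]; omega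
    · simp only [List.length_cons, List.length_nil]; omega

theorem ble_and_mod_beq {a r t : ℕ} (h : a ≤ t) (hr : t % 5 = r) :
    (Nat.ble a t).and ((t.mod 5).beq r) = true :=
  Bool.and_eq_true_iff.2 ⟨Nat.ble_eq_true_of_le h, by rw [Nat.beq_eq]; exact hr⟩

theorem patternSet_isDominatingSet_of_forall {α β : ℕ → Prop} [DecidablePred α] [DecidablePred β]
    (hfst : ∀ t < n / 2, α t ∨ β t ∨ β ((t + 1) % (n / 2)) ∨ β ((t + 3) % (n / 2)) ∨
      β ((t + 7) % (n / 2)))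
    (hsnd : ∀ t < n / 2, β ((t + 7) % (n / 2)) ∨ α ((t + 7) % (n / 2)) ∨
      α ((t + 6) % (n / 2)) ∨ α ((t + 4) % (n / 2)) ∨ α t) :
    (knodelGraph 4 n).IsDominatingSet (patternSet (n / 2) α β) :=
  SimpleGraph.isDominatingSet_iff.2 fun u =>
    patternSet_covers (fun _ => True) (fun t ht _ => hfst t ht) (fun t ht _ => hsnd t ht) u trivial

/-! ### Sporadic small cases -/

theorem stable_sixteen : (knodelGraph 4 16).IsDominationStable := by
  refine isDominationStable_of_le (k := 4) (by norm_num)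
    (patternSet_isDominatingSet_of_forall (α := fun t => t = 6 ∨ t = 7)
      (β := fun t => t = 3 ∨ t = 4) (by decide) (by decide)) ?_ fun w E hE => ?_
  · rw [card_patternSet]; decide
  · have := two_mul_le_card_of_covers_ne hE
    have := lt_card_of_covers_ne loop_search_eight_eighteen (by norm_num) (by decide) (by decide)
      (by decide) (by decide) hE
    omega

theorem stable_eighteen : (knodelGraph 4 18).IsDominationStable := by
  refine isDominationStable_of_le (k := 4) (by norm_num)
    (patternSet_isDominatingSet_of_forall (α := fun t => t = 7 ∨ t = 8)
      (β := fun t => t = 3 ∨ t = 4) (by decide) (by decide)) ?_ fun w E hE => ?_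
  · rw [card_patternSet]; decide
  · have := two_mul_le_card_of_covers_ne hE
    omega

theorem stable_twenty_eight : (knodelGraph 4 28).IsDominationStable := by
  refine isDominationStable_of_le (k := 7) (by norm_num)
    (patternSet_isDominatingSet_of_forall (α := fun t => t = 10 ∨ t = 12 ∨ t = 13)
      (β := fun t => t = 4 ∨ t = 7 ∨ t = 8 ∨ t = 9) (by decide) (by decide)) ?_ fun w E hE => ?_
  · rw [card_patternSet]; decide
  · have := lt_card_of_covers_ne loop_search_fourteen (by norm_num) (by decide) (by decide)
      (by decide) (by decide) hE
    omega

/-- The dominating set is the one used for `n = 18`, repeated with period 9. -/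
theorem stable_thirty_six : (knodelGraph 4 36).IsDominationStable := by
  refine isDominationStable_of_le (k := 8) (by norm_num)
    (patternSet_isDominatingSet_of_forall (α := fun t => t = 7 ∨ t = 8 ∨ t = 16 ∨ t = 17)
      (β := fun t => t = 3 ∨ t = 4 ∨ t = 12 ∨ t = 13) (by decide) (by decide)) ?_
    fun w E hE => ?_
  · rw [card_patternSet]; decide
  · have := lt_card_of_covers_ne loop_search_eight_eighteen (by norm_num) (by decide) (by decide)
      (by decide) (by decide) hE
    omega

theorem not_stable_twenty_six : ¬(knodelGraph 4 26).IsDominationStable := by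
  refine not_isDominationStable_of_lt (k := 6) (w := (0, ⟨2, by norm_num⟩))
    (D := patternSet (26 / 2) (fun t => t = 9 ∨ t = 11 ∨ t = 12)
      (fun t => t = 4 ∨ t = 7 ∨ t = 8))
    (fun u hu => patternSet_covers (fun u => u ≠ (0, ⟨2, by norm_num⟩)) ?_ ?_ u hu) ?_
    fun E hE => ?_
  · intro t ht htne
    have hne : t ≠ 2 := fun h => htne (Prod.ext rfl (Fin.ext h))
    revert t
    decide
  · intro t ht _
    revert t
    decide
  · rw [card_patternSet]; decide
  · have := lt_card_of_isDominatingSet loop_search_thirteen (by norm_num) (by decide) (by decide)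
      (by decide) (by decide) hE
    omega

/-! ### The residue classes of `n / 2` modulo 5 -/

theorem stable_of_mod_eq_zero (hm : 8 ≤ n / 2) (hr : n / 2 % 5 = 0) :
    (knodelGraph 4 n).IsDominationStable := by
  obtain ⟨D, hD, hc⟩ := exists_dominating_zero hm hr
  refine isDominationStable_of_le (by omega) hD hc fun w E hE => ?_
  have := two_mul_le_card_of_covers_ne hE
  omega

theorem stable_of_mod_eq_two (hm : 8 ≤ n / 2) (hr : n / 2 % 5 = 2) :
    (knodelGraph 4 n).IsDominationStable := by
  obtain ⟨D, hD, hc⟩ := exists_dominating_two (by omega) hr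
  refine isDominationStable_of_le (by omega) hD hc fun w E hE => ?_
  have := lt_card_of_covers_ne loop_search_two (by omega)
    (ble_and_mod_beq (by omega) hr) (by decide)
    (by decide) (by rw [hr]; decide) hE
  omega

theorem stable_of_mod_eq_three (hm : 23 ≤ n / 2) (hr : n / 2 % 5 = 3) :
    (knodelGraph 4 n).IsDominationStable := by
  obtain ⟨D, hD, hc⟩ := exists_dominating_three (by omega) hr
  refine isDominationStable_of_le (by omega) hD hc fun w E hE => ?_
  have := lt_card_of_covers_ne loop_search_three hm
    (ble_and_mod_beq hm hr) (by decide)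
    (by decide) (by rw [hr]; decide) hE
  omega

theorem not_stable_of_mod_eq_one (hm : 8 ≤ n / 2) (hr : n / 2 % 5 = 1) :
    ¬(knodelGraph 4 n).IsDominationStable := by
  obtain ⟨D, hD, hc⟩ := exists_covers_ne_one (n := n) (by omega) hr
  refine not_isDominationStable_of_lt hD hc fun E hE => ?_
  have := lt_card_of_isDominatingSet loop_search_one (by omega)
    (ble_and_mod_beq (by omega) hr) (by decide)
    (by decide) (by rw [hr]; decide) hE
  omega

theorem not_stable_of_mod_eq_four (hm : 19 ≤ n / 2) (hr : n / 2 % 5 = 4) :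
    ¬(knodelGraph 4 n).IsDominationStable := by
  obtain ⟨D, hD, hc⟩ := exists_covers_ne_four (n := n) (by omega) hr
  refine not_isDominationStable_of_lt hD hc fun E hE => ?_
  have := lt_card_of_isDominatingSet loop_search_four hm
    (ble_and_mod_beq hm hr) (by decide)
    (by decide) (by rw [hr]; decide) hE
  omega

end Knodel

theorem theorem4p6 (n : ℕ) (hn : 16 ≤ n) (heven : Even n) :
    (knodelGraph 4 n).IsDominationStable ↔
      (n = 18 ∨ n = 28) ∨
      (n ≡ 0 [MOD 10] ∨ n ≡ 4 [MOD 10]) ∨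
      (n ≠ 26 ∧ n ≡ 6 [MOD 10]) := by
  obtain ⟨m, rfl⟩ := heven
  have hm : (m + m) / 2 = m := by omega
  simp only [Nat.ModEq]
  rcases (by omega : m % 5 = 0 ∨ m % 5 = 1 ∨ m % 5 = 2 ∨ m % 5 = 3 ∨ m % 5 = 4) with
    hr | hr | hr | hr | hr
  · exact iff_of_true (Knodel.stable_of_mod_eq_zero (by omega) (by omega)) (by omega)
  · exact iff_of_false (Knodel.not_stable_of_mod_eq_one (by omega) (by omega)) (by omega)
  · exact iff_of_true (Knodel.stable_of_mod_eq_two (by omega) (by omega)) (by omega)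
  · rcases (by omega : m = 8 ∨ m = 13 ∨ m = 18 ∨ 23 ≤ m) with rfl | rfl | rfl | h
    · exact iff_of_true Knodel.stable_sixteen (by omega)
    · exact iff_of_false Knodel.not_stable_twenty_six (by omega)
    · exact iff_of_true Knodel.stable_thirty_six (by omega)
    · exact iff_of_true (Knodel.stable_of_mod_eq_three (by omega) (by omega)) (by omega)
  · rcases (by omega : m = 9 ∨ m = 14 ∨ 19 ≤ m) with rfl | rfl | h
    · exact iff_of_true Knodel.stable_eighteen (by omega)
    · exact iff_of_true Knodel.stable_twenty_eight (by omega)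
    · exact iff_of_false (Knodel.not_stable_of_mod_eq_four (by omega) (by omega)) (by omega)
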